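/- Let $\mathbb{K}$ be an algebraically closed field of characteristic $3$, and let $n \geq 1$ and $d \geq 3$ be integers. Let $V_{n,d} = \nu_d(\mathbb{P}^n) \subset \mathbb{P}^N$, $N = \binom{n+d}{n}-1$, be the $d$th Veronese variety, with homogeneous coordinates $z_I$ on $\mathbb{P}^N$ indexed by the exponents $I \in \mathbb{Z}_{\geq 0}^{n+1}$ with $|I| = d$, and let $I(V_{n,d}) \subset \mathbb{K}[z_I]$ be its homogeneous ideal. For $k \geq 0$ identify $H^0(\mathbb{P}^n,\mathcal{O}(k))$ with the space of forms of degree $k$ in $x_0,\dots,x_n$ (together with $0$), and let $\varphi$ be the $\mathbb{K}$-linear isomorphism from the forms of degree $d$ in $x_0,\dots,x_n$ onto the linear forms in the $z_I$ with $\varphi(x^I) = z_I$. For $s,t \in H^0(\mathbb{P}^n,\mathcal{O}(1))$ and $h \in H^0(\mathbb{P}^n,\mathcal{O}(d-2))$ put $$Q(s,t,h) = \varphi(s^2h)\,\varphi(t^2h) - \varphi(sth)^2 .$$ Let $\{s_1,\dots,s_p\}$ and $\{h_1,\dots,h_q\}$ be any bases of $H^0(\mathbb{P}^n,\mathcal{O}(1))$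 and $H^0(\mathbb{P}^n,\mathcal{O}(d-2))$ respectively (for instance the coordinates $x_0,\dots,x_n$ and the monomials of degree $d-2$), and let $H = \{h_1,\dots,h_q\} \cup \{h_i+h_j \mid 1 \le i<j \le q\}$. Let $\Gamma(\mathcal{O}(1),\mathcal{O}(d-2))$ be the set of all the following elements, where $h$ runs through $H$ and the indices run through $\{1,\dots,p\}$: * $Q(s_i,s_j,h)$ with $i<j$; * $Q(s_i+s_j,s_k,h)$ with $i<j$ and $k \neq i,j$; * $Q(s_i+s_j,s_k+s_l,h)$ with $i<j$, $k<l$, $i<k$ and $j \neq k,l$. Then $\Gamma(\mathcal{O}(1),\mathcal{O}(d-2))$ is a finite set of quadratic forms of rank $3$, and it generates the ideal $I(V_{n,d})$. -/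

import Mathlib

open MvPolynomial LinearAlgebra.Projectivization

noncomputable section

namespace Veronese

/-- The index set `A(n,d)` of exponents `I = (a_0, …, a_n)` with `a_0 + ⋯ + a_n = d`. -/
abbrev Idx (n d : ℕ) : Type := {I : Fin (n + 1) →₀ ℕ // ∑ i, I i = d}

instance instFintypeIdx (n d : ℕ) : Fintype (Idx n d) :=
  Fintype.subtype (Finset.finsuppAntidiag Finset.univ d) (by simp)

section Geometry

variable {K : Type*} [Field K]

/-- The monomial `x^I` evaluated at `x`, for all `I ∈ A(n,d)`. -/
def monomialVector (n d : ℕ) (x : Fin (n + 1) → K) : Idx n d → K :=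
  fun I => ∏ i, x i ^ I.1 i

theorem monomialVector_ne_zero (n d : ℕ) {x : Fin (n + 1) → K} (hx : x ≠ 0) :
    monomialVector n d x ≠ 0 := by
  obtain ⟨i, hi⟩ := Function.ne_iff.mp hx
  intro h
  have h1 := congrFun h ⟨Finsupp.single i d, by simp [Finsupp.single_apply]⟩
  simp only [monomialVector, Pi.zero_apply] at h1
  obtain ⟨j, -, hj⟩ := Finset.prod_eq_zero_iff.mp h1
  by_cases hij : i = j
  · subst hij
    exact hi (eq_zero_of_pow_eq_zero hj)
  · simp [hij] at hj

theorem monomialVector_smul (n d : ℕ) (t : K) (x : Fin (n + 1) → K) :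
    monomialVector n d (t • x) = t ^ d • monomialVector n d x := by
  funext I
  simp only [monomialVector, Pi.smul_apply, smul_eq_mul, mul_pow, Finset.prod_mul_distrib]
  rw [Finset.prod_pow_eq_pow_sum, I.2]

/-- The `d`-th Veronese embedding `ν_d : ℙⁿ → ℙᴺ`, where the homogeneous coordinates of `ℙᴺ` are
indexed by `A(n,d)`. -/
def veroneseMap (K : Type*) [Field K] (n d : ℕ) :
    ℙ K (Fin (n + 1) → K) → ℙ K (Idx n d → K) :=
  Projectivization.lift
    (fun x => Projectivization.mk K (monomialVector n d x.1) (monomialVector_ne_zero n d x.2))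
    (by
      intro a b t h
      rw [Projectivization.mk_eq_mk_iff']
      exact ⟨t ^ d, by rw [h, monomialVector_smul]⟩)

/-- The Veronese variety `V_{n,d} = ν_d(ℙⁿ) ⊂ ℙᴺ`, as a set of points. -/
def veroneseVariety (K : Type*) [Field K] (n d : ℕ) : Set (ℙ K (Idx n d → K)) :=
  Set.range (veroneseMap K n d)

/-- The homogeneous ideal of a set `X` of points of a projective space: the ideal generated by the
homogeneous polynomials that vanish at (every coordinate vector of) every point of `X`. -/
def homogeneousIdeal {σ : Type*} (X : Set (ℙ K (σ → K))) : Ideal (MvPolynomial σ K) :=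
  Ideal.span {F | (∃ m : ℕ, F.IsHomogeneous m) ∧
    ∀ (v : σ → K) (hv : v ≠ 0), Projectivization.mk K v hv ∈ X → eval v F = 0}

/-- `F` is a quadratic form of rank `r` (over a field of characteristic different from `2`):
`F = ∑ M_{ij} z_i z_j` with `M` symmetric of rank `r`. -/
def IsQuadricOfRank {σ : Type*} [Fintype σ] (F : MvPolynomial σ K) (r : ℕ) : Prop :=
  ∃ M : Matrix σ σ K, M.IsSymm ∧ M.rank = r ∧ F = ∑ i, ∑ j, C (M i j) * X i * X j

end Geometry

section Quadrics

variable {K : Type*} [Field K]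

/-- `H⁰(ℙⁿ, 𝒪(k))`: the forms of degree `k` in `x_0, …, x_n`. -/
abbrev Sec (K : Type*) [Field K] (n k : ℕ) : Submodule K (MvPolynomial (Fin (n + 1)) K) :=
  homogeneousSubmodule (Fin (n + 1)) K k

/-- The natural isomorphism `φ` from `H⁰(ℙⁿ, 𝒪(d))` onto the linear forms on `ℙᴺ`, sending the
monomial `x^I` to the coordinate `z_I`. -/
def phi (n d : ℕ) : Sec K n d →ₗ[K] MvPolynomial (Idx n d) K :=
  ∑ I : Idx n d,
    ((lcoeff K I.1).comp (Sec K n d).subtype).smulRight (X I : MvPolynomial (Idx n d) K)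

/-- The product `s ⊗ t ⊗ h ∈ H⁰(ℙⁿ, 𝒪(d))` for `s, t ∈ H⁰(ℙⁿ, 𝒪(ℓ))` and `h ∈ H⁰(ℙⁿ, 𝒪(m))`,
where `d = 2ℓ + m`. -/
def tripleProd {n ℓ m d : ℕ} (hd : 2 * ℓ + m = d) (s t : Sec K n ℓ) (h : Sec K n m) :
    Sec K n d :=
  ⟨s.1 * t.1 * h.1, by
    rw [mem_homogeneousSubmodule, ← hd, two_mul]
    exact (IsHomogeneous.mul s.2 t.2).mul h.2⟩

/-- `Q(s,t,h) = φ(s ⊗ s ⊗ h) φ(t ⊗ t ⊗ h) - φ(s ⊗ t ⊗ h)²`. -/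
def Q {n ℓ m d : ℕ} (hd : 2 * ℓ + m = d) (s t : Sec K n ℓ) (h : Sec K n m) :
    MvPolynomial (Idx n d) K :=
  phi n d (tripleProd hd s s h) * phi n d (tripleProd hd t t h) -
    phi n d (tripleProd hd s t h) ^ 2

/-- `Δ₁ = {(i,j) | i < j}`. -/
def Delta1 (p : ℕ) : Set (Fin p × Fin p) := {x | x.1 < x.2}

/-- `Δ₂ = {(i,j,k) | (i,j) ∈ Δ₁, k ≠ i, j}`. -/
def Delta2 (p : ℕ) : Set (Fin p × Fin p × Fin p) :=
  {x | (x.1, x.2.1) ∈ Delta1 p ∧ x.2.2 ≠ x.1 ∧ x.2.2 ≠ x.2.1}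

/-- `Δ₃ = {(i,j,k,l) | (i,j), (k,l) ∈ Δ₁, i < k, j ≠ k, l}`. -/
def Delta3 (p : ℕ) : Set (Fin p × Fin p × Fin p × Fin p) :=
  {x | (x.1, x.2.1) ∈ Delta1 p ∧ (x.2.2.1, x.2.2.2) ∈ Delta1 p ∧ x.1 < x.2.2.1 ∧
    x.2.1 ≠ x.2.2.1 ∧ x.2.1 ≠ x.2.2.2}

/-- `H = {h_1, …, h_q} ∪ {h_i + h_j | i < j}`. -/
def sumSet {V : Type*} [AddCommGroup V] {q : ℕ} (h : Fin q → V) : Set V :=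
  {g | ∃ i, g = h i} ∪ {g | ∃ i j, i < j ∧ g = h i + h j}

/-- `Γ₁₁ = {Q(s_i, s_j, h) | (i,j) ∈ Δ₁, h ∈ H}`. -/
def Gamma11 {n ℓ m d p q : ℕ} (hd : 2 * ℓ + m = d) (s : Fin p → Sec K n ℓ)
    (h : Fin q → Sec K n m) : Set (MvPolynomial (Idx n d) K) :=
  {F | ∃ i j, (i, j) ∈ Delta1 p ∧ ∃ g ∈ sumSet h, F = Q hd (s i) (s j) g}

/-- `Γ₁₂ = {Q(s_i + s_j, s_k, h) | (i,j,k) ∈ Δ₂, h ∈ H}`. -/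
def Gamma12 {n ℓ m d p q : ℕ} (hd : 2 * ℓ + m = d) (s : Fin p → Sec K n ℓ)
    (h : Fin q → Sec K n m) : Set (MvPolynomial (Idx n d) K) :=
  {F | ∃ i j k, (i, j, k) ∈ Delta2 p ∧ ∃ g ∈ sumSet h, F = Q hd (s i + s j) (s k) g}

/-- `Γ₂₂ = {Q(s_i + s_j, s_k + s_l, h) | (i,j,k,l) ∈ Δ₃, h ∈ H}`. -/
def Gamma22 {n ℓ m d p q : ℕ} (hd : 2 * ℓ + m = d) (s : Fin p → Sec K n ℓ)
    (h : Fin q → Sec K n m) : Set (MvPolynomial (Idx n d) K) :=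
  {F | ∃ i j k l, (i, j, k, l) ∈ Delta3 p ∧ ∃ g ∈ sumSet h,
    F = Q hd (s i + s j) (s k + s l) g}

/-- `Γ(𝒪(ℓ), 𝒪(m)) = Γ₁₁ ∪ Γ₁₂ ∪ Γ₂₂`, for a basis `s` of `H⁰(ℙⁿ, 𝒪(ℓ))` and a basis `h` of
`H⁰(ℙⁿ, 𝒪(m))`. -/
def Gamma {n ℓ m d p q : ℕ} (hd : 2 * ℓ + m = d) (s : Module.Basis (Fin p) K (Sec K n ℓ))
    (h : Module.Basis (Fin q) K (Sec K n m)) : Set (MvPolynomial (Idx n d) K) :=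
  Gamma11 hd s h ∪ Gamma12 hd s h ∪ Gamma22 hd s h

end Quadrics

end Veronese

end

noncomputable section

namespace Veronese

/-! ### Six-term relations on pairs of multisets -/

section Combinatorics

variable {α R : Type*} [CommRing R]

/-! Work modulo the ideal `J` spanned by `Gamma` and let `Z s t h` be the class of `φ(sth)`, a
trilinear form symmetric in `s`, `t`. For fixed `h`, write `w(a,b,c,e) = Z_ab Z_ce + Z_ac Z_be +
Z_ae Z_bc`, which is totally symmetric. Since `-1 = 2` in characteristic 3, `Q(s,t,h)` is exactly
`w(s,s,t,t)`, while `w(s,s,s,t) = 3 Z_ss Z_st = 0` for free. The three families in `Gamma` are what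
is needed to recover every value of `w` on a basis from values on squares, and the sums `h_i + h_j`
polarize once more in `h`. Hence the six-term form `symmForm` vanishes identically modulo `J`
(`symmForm_tripleForm_span_Gamma`).

On monomials this is a linear relation among the products `z_A z_B`, with `A`, `B` read as multisets
of size `d`. For `d ≥ 3` these relations force `z_A z_B` to depend only on `A + B`
(`eq_of_add_eq_add`), so `J` contains all binomials `z_A z_B - z_A' z_B'` with `A + B = A' + B'`.
These generate the kernel of `z_I ↦ x^I` (`ker_pullback_le`), which contains the homogeneous ideal
because the field is infinite. The reverse inclusion is `(s²h)(t²h) = (sth)²`.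

The rank is 3 because `s²h`, `sth`, `t²h` are linearly independent when `s`, `t` are and `h ≠ 0`. -/

/-- The sum of `F (P + S) (Pᶜ + S')` over the six two-element parts `P` of `{a, b, c, e}`. -/
def sixTerm (F : Multiset α → Multiset α → R) (S S' : Multiset α) (a b c e : α) : R :=
  F (a ::ₘ b ::ₘ S) (c ::ₘ e ::ₘ S') + F (a ::ₘ c ::ₘ S) (b ::ₘ e ::ₘ S') +
  F (a ::ₘ e ::ₘ S) (b ::ₘ c ::ₘ S') + F (b ::ₘ c ::ₘ S) (a ::ₘ e ::ₘ S') +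
  F (b ::ₘ e ::ₘ S) (a ::ₘ c ::ₘ S') + F (c ::ₘ e ::ₘ S) (a ::ₘ b ::ₘ S')

/-- With `D(T,T') = F(aT,bT') - F(bT,aT')`, this says `D(cS,eS') = D(eS,cS')`. Subtracting from a
six-term relation its image under `a ↔ b` kills every term with `a` and `b` on the same side;
subtracting then the image under `c ↔ e` kills the terms that put `x` or `y` beside `a` or `b`. Two
spare elements `x`, `y` of `S'` are used, hence `4 ≤ d`. -/
theorem second_difference_eq_zero {F : Multiset α → Multiset α → R} {d : ℕ}
    (rel : ∀ S S' a b c e, S.card + 2 = d → S'.card + 2 = d → sixTerm F S S' a b c e = 0)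
    (hd : 4 ≤ d) {S S' : Multiset α} (hS : S.card + 2 = d) (hS' : S'.card + 2 = d)
    (a b c e : α) :
    F (a ::ₘ c ::ₘ S) (b ::ₘ e ::ₘ S') - F (b ::ₘ c ::ₘ S) (a ::ₘ e ::ₘ S') =
      F (a ::ₘ e ::ₘ S) (b ::ₘ c ::ₘ S') - F (b ::ₘ e ::ₘ S) (a ::ₘ c ::ₘ S') := by
  obtain ⟨x, S₁, rfl⟩ : ∃ x S₁, S' = x ::ₘ S₁ := by
    obtain ⟨x, hx⟩ := Multiset.card_pos_iff_exists_mem.mp (by omega : 0 < S'.card)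
    obtain ⟨S₁, h₁⟩ := Multiset.exists_cons_of_mem hx
    exact ⟨x, S₁, h₁⟩
  rw [Multiset.card_cons] at hS'
  obtain ⟨y, S₂, rfl⟩ : ∃ y S₂, S₁ = y ::ₘ S₂ := by
    obtain ⟨x, hx⟩ := Multiset.card_pos_iff_exists_mem.mp (by omega : 0 < S₁.card)
    obtain ⟨S₁, h₁⟩ := Multiset.exists_cons_of_mem hx
    exact ⟨x, S₁, h₁⟩
  rw [Multiset.card_cons] at hS'
  have r1 := rel S (b ::ₘ e ::ₘ S₂) c x y a hS (by simpa using hS')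
  have r2 := rel S (a ::ₘ e ::ₘ S₂) c x y b hS (by simpa using hS')
  have r3 := rel S (b ::ₘ c ::ₘ S₂) e x y a hS (by simpa using hS')
  have r4 := rel S (a ::ₘ c ::ₘ S₂) e x y b hS (by simpa using hS')
  simp only [sixTerm, Multiset.cons_swap] at r1 r2 r3 r4 ⊢
  linear_combination r1 - r2 - r3 + r4

/-- Repeated swaps give `D(T,T') = D(T',T)`, whereas the symmetry of `F` gives `D(T',T) = -D(T,T')`.
So `2D = 0`, and `2` is invertible because `3 = 0`. -/
theorem exchange_of_four_le {F : Multiset α → Multiset α → R} {d : ℕ} (h3 : (3 : R) = 0)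
    (symm : ∀ A B, F A B = F B A)
    (rel : ∀ S S' a b c e, S.card + 2 = d → S'.card + 2 = d → sixTerm F S S' a b c e = 0)
    (hd : 4 ≤ d) {T T' : Multiset α} (hT : T.card + 1 = d) (hT' : T'.card + 1 = d) (a b : α) :
    F (a ::ₘ T) (b ::ₘ T') = F (b ::ₘ T) (a ::ₘ T') := by
  have key : ∀ T T' U U' : Multiset α, T.card = T'.card → U.card = U'.card →
      T.card + U.card + 1 = d →
      F (a ::ₘ (T + U)) (b ::ₘ (T' + U')) - F (b ::ₘ (T + U)) (a ::ₘ (T' + U')) =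
      F (a ::ₘ (T' + U)) (b ::ₘ (T + U')) - F (b ::ₘ (T' + U)) (a ::ₘ (T + U')) := by
    intro T
    induction T using Multiset.induction_on with
    | empty =>
      intro T' U U' h _ _
      obtain rfl := Multiset.card_eq_zero.mp (h.symm.trans Multiset.card_zero)
      rfl
    | cons c T ih =>
      intro T' U U' h hU hd'
      obtain ⟨e, T', rfl⟩ : ∃ e T₁, T' = e ::ₘ T₁ := by
        obtain ⟨x, hx⟩ := Multiset.card_pos_iff_exists_mem.mp
          (by rw [← h]; simp : 0 < T'.card)
        exact ⟨x, Multiset.exists_cons_of_mem hx⟩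
      simp only [Multiset.card_cons, Nat.add_right_cancel_iff] at h hd'
      have h1 := second_difference_eq_zero rel hd (S := T + U) (S' := T' + U')
        (by simp; omega) (by simp; omega) a b c e
      have h2 := ih T' (e ::ₘ U) (c ::ₘ U') h (by simpa using hU) (by simp; omega)
      simp only [Multiset.add_cons] at h2
      simp only [Multiset.cons_add]
      exact h1.trans h2
  have h := key T T' 0 0 (by omega) rfl (by simpa using hT)
  simp only [add_zero] at h
  rw [symm (a ::ₘ T') (b ::ₘ T), symm (b ::ₘ T') (a ::ₘ T)] at h
  linear_combination (F (a ::ₘ T) (b ::ₘ T') - F (b ::ₘ T) (a ::ₘ T')) * h3 - h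

/-- Write `G(xy) = F(axy, b..) - F(bxy, a..)` for a pair `xy` out of `s, t, u, v`, the dots being
the other pair. The four differences of relations under `a ↔ b` add up to `4 G(st) + 2 (G(su) +
G(sv) + G(tu) + G(tv))`. By symmetry of `F`, complementary pairs have opposite `G`, so the bracket
vanishes, and `4 = 1`. -/
theorem exchange_of_eq_three {F : Multiset α → Multiset α → R} (h3 : (3 : R) = 0)
    (symm : ∀ A B, F A B = F B A)
    (rel : ∀ S S' a b c e, S.card + 2 = 3 → S'.card + 2 = 3 → sixTerm F S S' a b c e = 0)
    {T T' : Multiset α} (hT : T.card + 1 = 3) (hT' : T'.card + 1 = 3) (a b : α) :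
    F (a ::ₘ T) (b ::ₘ T') = F (b ::ₘ T) (a ::ₘ T') := by
  obtain ⟨s, t, rfl⟩ := Multiset.card_eq_two.mp (by omega : T.card = 2)
  obtain ⟨u, v, rfl⟩ := Multiset.card_eq_two.mp (by omega : T'.card = 2)
  have r1 := rel {a} {u} b s t v rfl rfl
  have r2 := rel {a} {v} b s t u rfl rfl
  have r3 := rel {s} {b} a t u v rfl rfl
  have r4 := rel {t} {b} a s u v rfl rfl
  have r5 := rel {b} {u} a s t v rfl rfl
  have r6 := rel {b} {v} a s t u rfl rfl
  have r7 := rel {s} {a} b t u v rfl rfl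
  have r8 := rel {t} {a} b s u v rfl rfl
  simp only [sixTerm, Multiset.insert_eq_cons, ← Multiset.cons_zero] at r1 r2 r3 r4 r5 r6 r7 r8 ⊢
  simp only [Multiset.cons_swap, symm] at r1 r2 r3 r4 r5 r6 r7 r8 ⊢
  linear_combination r1 + r2 + r3 + r4 - r5 - r6 - r7 - r8
    - (F (a ::ₘ s ::ₘ t ::ₘ 0) (b ::ₘ u ::ₘ v ::ₘ 0) - F (b ::ₘ s ::ₘ t ::ₘ 0) (a ::ₘ u ::ₘ v ::ₘ 0)) * h3

/-- A symmetric function of pairs of multisets of size `d ≥ 3` subject to the six-term relations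
depends only on the sum of the two multisets. -/
theorem eq_of_add_eq_add {F : Multiset α → Multiset α → R} {d : ℕ} (h3 : (3 : R) = 0)
    (symm : ∀ A B, F A B = F B A)
    (rel : ∀ S S' a b c e, S.card + 2 = d → S'.card + 2 = d → sixTerm F S S' a b c e = 0)
    (hd : 3 ≤ d) {A B A' B' : Multiset α} (hA : A.card = d) (hB : B.card = d)
    (hA' : A'.card = d) (h : A + B = A' + B') :
    F A B = F A' B' := by
  have exch : ∀ T T' : Multiset α, T.card + 1 = d → T'.card + 1 = d → ∀ a b : α,
      F (a ::ₘ T) (b ::ₘ T') = F (b ::ₘ T) (a ::ₘ T') := by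
    intro T T' hT hT' a b
    rcases hd.lt_or_eq with hd | rfl
    · exact exchange_of_four_le h3 symm rel hd hT hT' a b
    · exact exchange_of_eq_three h3 symm rel hT hT' a b
  have key : ∀ T T' U U' : Multiset α, T.card = T'.card → U.card = U'.card →
      T.card + U.card = d → F (T + U) (T' + U') = F (T' + U) (T + U') := by
    intro T
    induction T using Multiset.induction_on with
    | empty =>
      intro T' U U' h _ _
      obtain rfl := Multiset.card_eq_zero.mp (h.symm.trans Multiset.card_zero)
      rfl
    | cons a T ih =>
      intro T' U U' h hU hd'
      obtain ⟨b, T', rfl⟩ : ∃ e T₁, T' = e ::ₘ T₁ := by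
        obtain ⟨x, hx⟩ := Multiset.card_pos_iff_exists_mem.mp
          (by rw [← h]; simp : 0 < T'.card)
        exact ⟨x, Multiset.exists_cons_of_mem hx⟩
      simp only [Multiset.card_cons, Nat.add_right_cancel_iff] at h hd'
      have h2 := ih T' (b ::ₘ U) (a ::ₘ U') h (by simpa using hU) (by simp; omega)
      simp only [Multiset.add_cons] at h2
      simp only [Multiset.cons_add]
      exact (exch _ _ (by simp; omega) (by simp; omega) a b).trans h2
  classical
  -- `A` and `A'` differ by trading `A - A'` for `A' - A`, which have equal size; the latter lies in
  -- `B`, so `key` makes the trade.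
  have e1 : A - A' + A ∩ A' = A := Multiset.sub_add_inter A A'
  have e2 : A' - A + A ∩ A' = A' := by rw [Multiset.inter_comm]; exact Multiset.sub_add_inter A' A
  have hle : A' - A ≤ B := by
    rw [tsub_le_iff_left, h]
    exact le_self_add
  have e3 : A' - A + (B - (A' - A)) = B := add_tsub_cancel_of_le hle
  have e4 : A - A' + (B - (A' - A)) = B' := by
    have : A' + (A - A' + (B - (A' - A))) = A' + B' := by
      calc A' + (A - A' + (B - (A' - A)))
          = (A' - A + A ∩ A') + (A - A' + (B - (A' - A))) := by rw [e2]
        _ = (A - A' + A ∩ A') + (A' - A + (B - (A' - A))) := by ac_rfl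
        _ = A' + B' := by rw [e1, e3, h]
    exact add_left_cancel this
  have c1 := congrArg Multiset.card e1
  have c2 := congrArg Multiset.card e2
  have c3 := congrArg Multiset.card e3
  rw [Multiset.card_add] at c1 c2 c3
  have := key (A - A') (A' - A) (A ∩ A') (B - (A' - A)) (by omega) (by omega) (by omega)
  rwa [e1, e2, e3, e4] at this

end Combinatorics

/-! ### The toric ideal is generated by quadratic binomials -/

section Toric

variable {K : Type*} [Field K] {n d : ℕ}

theorem exists_between_degree {σ : Type*} [Fintype σ] [DecidableEq σ] {β w : σ →₀ ℕ} (h : β ≤ w)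
    {d : ℕ} (h1 : ∑ i, β i ≤ d) (h2 : d ≤ ∑ i, w i) :
    ∃ B : σ →₀ ℕ, β ≤ B ∧ B ≤ w ∧ ∑ i, B i = d := by
  induction d, h1 using Nat.le_induction with
  | base => exact ⟨β, le_rfl, h, rfl⟩
  | succ d _ ih =>
    obtain ⟨B, hB1, hB2, hB3⟩ := ih (by omega)
    obtain ⟨i, -, hi⟩ := Finset.exists_lt_of_sum_lt (s := Finset.univ) (by omega : ∑ i, B i < ∑ i, w i)
    refine ⟨B + Finsupp.single i 1, hB1.trans le_self_add, fun j => ?_, ?_⟩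
    · by_cases hj : i = j
      · subst hj; simpa using hi
      · simpa [Finsupp.single_apply, hj] using hB2 j
    · simp [Finset.sum_add_distrib, hB3, Finsupp.single_apply]

/-- The total exponent of a multiset of indices. -/
def totalExponent (L : Multiset (Idx n d)) : Fin (n + 1) →₀ ℕ := (L.map Subtype.val).sum

theorem totalExponent_cons (A : Idx n d) (L : Multiset (Idx n d)) :
    totalExponent (A ::ₘ L) = A.1 + totalExponent L := by
  simp [totalExponent]

/-- The `K`-algebra homomorphism `z_I ↦ x^I`. -/
def pullback (K : Type*) [Field K] (n d : ℕ) :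
    MvPolynomial (Idx n d) K →ₐ[K] MvPolynomial (Fin (n + 1)) K :=
  aeval fun I => monomial I.1 1

theorem pullback_prod_X (L : Multiset (Idx n d)) :
    pullback K n d (L.map X).prod = monomial (totalExponent L) 1 := by
  induction L using Multiset.induction_on with
  | empty => simp [totalExponent]
  | cons A L ih =>
    rw [Multiset.map_cons, Multiset.prod_cons, map_mul, ih, totalExponent_cons, pullback, aeval_X,
      monomial_mul, one_mul]

theorem eq_of_val_le {A B : Idx n d} (h : A.1 ≤ B.1) : A = B := by
  apply Subtype.ext
  ext i
  have := (Finset.sum_eq_sum_iff_of_le (s := Finset.univ) fun i _ => h i).mp (A.2.trans B.2.symm)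
  exact this i (Finset.mem_univ i)

theorem le_sum_totalExponent {L : Multiset (Idx n d)} (hL : L ≠ 0) :
    d ≤ ∑ i, totalExponent L i := by
  obtain ⟨A, hA⟩ := Multiset.exists_mem_of_ne_zero hL
  obtain ⟨L, rfl⟩ := Multiset.exists_cons_of_mem hA
  simp [totalExponent_cons, Finset.sum_add_distrib, A.2]

variable {S : Type*} [CommRing S] {f : Idx n d → S}

/-- Any `A` dividing the total monomial can be made a factor. For `I ::ₘ L`, choose `B` of degree
`d` between `A - I` and the exponent of `L`, extract `B` from `L` by induction, and replace the pair
`I, B` by `A, I + B - A` using `hf`. -/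
theorem exists_prod_eq_mul
    (hf : ∀ A B A' B' : Idx n d, A.1 + B.1 = A'.1 + B'.1 → f A * f B = f A' * f B')
    (L : Multiset (Idx n d)) (hL : L ≠ 0) (A : Idx n d) (hA : A.1 ≤ totalExponent L) :
    ∃ L', totalExponent L = A.1 + totalExponent L' ∧ (L.map f).prod = f A * (L'.map f).prod := by
  induction L using Multiset.induction_on generalizing A with
  | empty => exact absurd rfl hL
  | cons I L ih =>
    rw [totalExponent_cons] at hA ⊢
    rcases eq_or_ne L 0 with rfl | hL0
    · obtain rfl : A = I := eq_of_val_le (by simpa [totalExponent] using hA)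
      exact ⟨0, rfl, by simp⟩
    · have h1 : ∑ i, (A.1 - I.1) i ≤ d := by
        calc ∑ i, (A.1 - I.1) i ≤ ∑ i, A.1 i := Finset.sum_le_sum fun i _ => by simp
          _ = d := A.2
      obtain ⟨B, hB1, hB2, hB3⟩ := exists_between_degree (tsub_le_iff_left.mpr hA) h1
        (le_sum_totalExponent hL0)
      obtain ⟨L', hL', hp⟩ := ih hL0 ⟨B, hB3⟩ hB2
      have hAB : A.1 ≤ I.1 + B := tsub_le_iff_left.mp hB1
      have hC : A.1 + (I.1 + B - A.1) = I.1 + B := add_tsub_cancel_of_le hAB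
      have hC' : ∑ i, (I.1 + B - A.1) i = d := by
        have := congrArg (fun g : Fin (n + 1) →₀ ℕ => ∑ i, g i) hC
        simp only [Finsupp.add_apply, Finset.sum_add_distrib, A.2, I.2, hB3] at this
        omega
      refine ⟨⟨_, hC'⟩ ::ₘ L', ?_, ?_⟩
      · rw [totalExponent_cons, hL', ← add_assoc, ← add_assoc, hC]
      · rw [Multiset.map_cons, Multiset.prod_cons, Multiset.map_cons, Multiset.prod_cons, hp,
          ← mul_assoc, ← mul_assoc, hf I ⟨B, hB3⟩ A ⟨_, hC'⟩ hC.symm]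

theorem prod_eq_of_totalExponent_eq (hd : 0 < d)
    (hf : ∀ A B A' B' : Idx n d, A.1 + B.1 = A'.1 + B'.1 → f A * f B = f A' * f B')
    (L L' : Multiset (Idx n d)) (h : totalExponent L = totalExponent L') :
    (L.map f).prod = (L'.map f).prod := by
  have hne : ∀ L : Multiset (Idx n d), totalExponent L = 0 → L = 0 := by
    intro L h0
    by_contra hL
    have := le_sum_totalExponent hL
    rw [h0] at this
    simp at this
    omega
  induction L using Multiset.induction_on generalizing L' with
  | empty => rw [hne L' h.symm]
  | cons A L ih =>
    rw [totalExponent_cons] at h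
    have hL' : L' ≠ 0 := by
      rintro rfl
      have : totalExponent (A ::ₘ L) = 0 := by rw [totalExponent_cons, h]; rfl
      simpa using hne _ this
    obtain ⟨L'', h1, h2⟩ := exists_prod_eq_mul hf L' hL' A (h ▸ le_self_add)
    rw [h2, Multiset.map_cons, Multiset.prod_cons, ih L'' (add_left_cancel (h.trans h1))]

/-- An ideal that contains all the quadrics `z_A z_B - z_A' z_B'` with `A + B = A' + B'` contains
the whole toric ideal of the Veronese variety. -/
theorem ker_pullback_le (hd : 0 < d) (J : Ideal (MvPolynomial (Idx n d) K))
    (hJ : ∀ A B A' B' : Idx n d, A.1 + B.1 = A'.1 + B'.1 →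
      Ideal.Quotient.mk J (X A) * Ideal.Quotient.mk J (X B) =
        Ideal.Quotient.mk J (X A') * Ideal.Quotient.mk J (X B')) :
    RingHom.ker (pullback K n d) ≤ J := by
  classical
  let f : Idx n d → MvPolynomial (Idx n d) K ⧸ J := fun A => Ideal.Quotient.mk J (X A)
  let rep : (Fin (n + 1) →₀ ℕ) → Multiset (Idx n d) :=
    fun w => if h : ∃ L, totalExponent L = w then h.choose else 0
  have hrep : ∀ L : Multiset (Idx n d), totalExponent (rep (totalExponent L)) = totalExponent L := by
    intro L
    have h : ∃ L', totalExponent L' = totalExponent L := ⟨L, rfl⟩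
    simp only [rep, dif_pos h]
    exact h.choose_spec
  -- Sending `x^w` to the class of any product of coordinates with exponent `w` factors the quotient
  -- map through `pullback`, so the kernel of `pullback` dies modulo `J`. The value on exponents
  -- that are not totals is irrelevant.
  let ψ : MvPolynomial (Fin (n + 1)) K →ₗ[K] MvPolynomial (Idx n d) K ⧸ J :=
    (basisMonomials (Fin (n + 1)) K).constr K fun w => ((rep w).map f).prod
  have hψ : ψ ∘ₗ (pullback K n d).toLinearMap = (Ideal.Quotient.mkₐ K J).toLinearMap := by
    refine (basisMonomials (Idx n d) K).ext fun u => ?_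
    have hu : (monomial u 1 : MvPolynomial (Idx n d) K) = (u.toMultiset.map X).prod := by
      rw [monomial_eq, C_1, one_mul, Finsupp.toMultiset_map, Finsupp.prod_toMultiset]
      rw [Finsupp.prod_mapDomain_index (by simp) (by intros; exact pow_add _ _ _)]
    have hb : ∀ w, ψ (monomial w 1) = ((rep w).map f).prod := fun w => by
      have := (basisMonomials (Fin (n + 1)) K).constr_basis K
        (fun w => ((rep w).map f).prod) w
      rwa [coe_basisMonomials] at this
    simp only [coe_basisMonomials, LinearMap.comp_apply, AlgHom.toLinearMap_apply]
    rw [hu, pullback_prod_X, hb, prod_eq_of_totalExponent_eq hd hJ _ _ (hrep _),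
      Ideal.Quotient.mkₐ_eq_mk, map_multiset_prod, Multiset.map_map]
    rfl
  intro F hF
  have := LinearMap.congr_fun hψ F
  simp only [LinearMap.comp_apply, AlgHom.toLinearMap_apply, RingHom.mem_ker.mp hF, map_zero,
    Ideal.Quotient.mkₐ_eq_mk] at this
  exact Ideal.Quotient.eq_zero_iff_mem.mp this.symm

end Toric

/-! ### The Veronese ideal and the elements of Γ -/

section Ideal

variable {K : Type*} [Field K] {n d : ℕ}

theorem eval_pullback (x : Fin (n + 1) → K) (F : MvPolynomial (Idx n d) K) :
    eval x (pullback K n d F) = eval (monomialVector n d x) F := by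
  induction F using MvPolynomial.induction_on with
  | C a => simp [pullback]
  | add p q hp hq => simp only [map_add, hp, hq]
  | mul_X p I hp =>
    rw [map_mul, map_mul, map_mul, hp, eval_X, pullback, aeval_X, eval_monomial, one_mul,
      Finsupp.prod_fintype _ _ (by simp)]
    rfl

theorem mk_monomialVector_mem {x : Fin (n + 1) → K} (hx : x ≠ 0) :
    Projectivization.mk K (monomialVector n d x) (monomialVector_ne_zero n d hx) ∈
      veroneseVariety K n d :=
  ⟨Projectivization.mk K x hx, rfl⟩

theorem exists_eq_smul_of_mem {v : Idx n d → K} (hv : v ≠ 0)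
    (h : Projectivization.mk K v hv ∈ veroneseVariety K n d) :
    ∃ (a : K) (x : Fin (n + 1) → K), v = a • monomialVector n d x := by
  obtain ⟨P, hP⟩ := h
  induction P using Projectivization.ind with
  | h x hx =>
    change Projectivization.mk K (monomialVector n d x) (monomialVector_ne_zero n d hx) = _ at hP
    obtain ⟨a, ha⟩ := (Projectivization.mk_eq_mk_iff' K _ _ _ _).mp hP.symm
    exact ⟨a, x, ha.symm⟩

theorem homogeneousIdeal_le_ker_pullback [Infinite K] :
    homogeneousIdeal (veroneseVariety K n d) ≤ RingHom.ker (pullback K n d) := by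
  rw [homogeneousIdeal, Ideal.span_le]
  rintro F ⟨-, hF⟩
  -- `pullback K n d F` is only known to vanish at nonzero points; the factor `X 0` takes care of
  -- the origin.
  have h : X 0 * pullback K n d F = 0 := by
    refine MvPolynomial.funext fun x => ?_
    rw [map_mul, eval_X, map_zero, eval_pullback]
    rcases eq_or_ne x 0 with rfl | hx
    · simp
    · rw [hF _ _ (mk_monomialVector_mem hx), mul_zero]
  exact (mul_eq_zero.mp h).resolve_left (X_ne_zero 0)

theorem phi_apply (g : Sec K n d) : phi n d g = ∑ I : Idx n d, C (coeff I.1 g.1) * X I := by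
  simp [phi, MvPolynomial.smul_eq_C_mul]

theorem phi_isHomogeneous (g : Sec K n d) : (phi n d g).IsHomogeneous 1 := by
  rw [phi_apply]
  exact IsHomogeneous.sum _ _ _ fun I _ => by simpa using (isHomogeneous_C _ _).mul (isHomogeneous_X K I)

theorem pullback_phi (g : Sec K n d) : pullback K n d (phi n d g) = g.1 := by
  rw [phi_apply, map_sum]
  ext w
  rw [coeff_sum]
  by_cases hw : ∑ i, w i = d
  · rw [Finset.sum_eq_single ⟨w, hw⟩]
    · simp [pullback, coeff_C_mul]
    · rintro I - hI
      have : I.1 ≠ w := fun e => hI (Subtype.ext e)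
      simp [pullback, coeff_C_mul, this]
    · simp
  · have h0 : coeff w g.1 = 0 := by
      by_contra hne
      have := g.2 hne
      rw [Finsupp.weight_apply, Finsupp.sum_fintype _ _ (by simp)] at this
      exact hw (by simpa using this)
    rw [h0]
    refine Finset.sum_eq_zero fun I _ => ?_
    have : I.1 ≠ w := fun e => hw (e ▸ I.2)
    simp [pullback, coeff_C_mul, this]

theorem phi_injective : Function.Injective (phi (K := K) n d) := fun g g' h =>
  Subtype.ext (by rw [← pullback_phi g, ← pullback_phi g', h])

theorem phi_monomial (I : Idx n d) (hI : monomial I.1 1 ∈ Sec K n d) :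
    phi n d ⟨monomial I.1 1, hI⟩ = X I := by
  classical
  rw [phi_apply, Finset.sum_eq_single I]
  · simp
  · intro I' _ h
    have : I.1 ≠ I'.1 := fun e => h (Subtype.ext e.symm)
    simp [coeff_monomial, this]
  · simp

theorem eval_smul_monomialVector_phi (a : K) (x : Fin (n + 1) → K) (g : Sec K n d) :
    eval (a • monomialVector n d x) (phi n d g) = a * eval x g.1 := by
  rw [← pullback_phi g, eval_pullback, phi_apply]
  simp only [map_sum, map_mul, eval_C, eval_X, Pi.smul_apply, smul_eq_mul, Finset.mul_sum]
  exact Finset.sum_congr rfl fun I _ => by ring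

theorem Q_mem_homogeneousIdeal {ℓ m : ℕ} (hd : 2 * ℓ + m = d) (s t : Sec K n ℓ) (h : Sec K n m) :
    Q hd s t h ∈ homogeneousIdeal (veroneseVariety K n d) := by
  refine Ideal.subset_span ⟨⟨2, ?_⟩, ?_⟩
  · rw [Q, sq]
    exact ((phi_isHomogeneous _).mul (phi_isHomogeneous _)).sub
      ((phi_isHomogeneous _).mul (phi_isHomogeneous _))
  · intro v hv hmem
    obtain ⟨a, x, rfl⟩ := exists_eq_smul_of_mem hv hmem
    simp only [Q, map_sub, map_mul, map_pow, eval_smul_monomialVector_phi, tripleProd]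
    ring

/-- The index conditions make the two arguments independent: each case reads off two basis
coordinates that separate them. -/
theorem exists_eq_Q_of_mem_Gamma {ℓ m p q : ℕ} {hd : 2 * ℓ + m = d}
    {s : Module.Basis (Fin p) K (Sec K n ℓ)} {h : Module.Basis (Fin q) K (Sec K n m)}
    {F : MvPolynomial (Idx n d) K} (hF : F ∈ Gamma hd s h) :
    ∃ a b g, LinearIndependent K ![a, b] ∧ g ≠ 0 ∧ F = Q hd a b g := by
  have hpair : ∀ {v w : Sec K n ℓ}, (∀ x y : K, x • v + y • w = 0 → x = 0 ∧ y = 0) →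
      LinearIndependent K ![v, w] := fun H => LinearIndependent.pair_iff.mpr H
  have hg : ∀ g ∈ sumSet h, g ≠ 0 := by
    rintro g (⟨i, rfl⟩ | ⟨i, j, hij, rfl⟩) h0
    · exact h.ne_zero i h0
    · have := congrArg (fun v => h.repr v i) h0
      simp [hij.ne'] at this
  rcases hF with (⟨i, j, hij, g, hgm, rfl⟩ | ⟨i, j, k, ⟨hij, hki, hkj⟩, g, hgm, rfl⟩) |
    ⟨i, j, k, l, ⟨hij, hkl, hik, hjk, hjl⟩, g, hgm, rfl⟩
  · refine ⟨_, _, g, hpair fun x y hxy => ?_, hg g hgm, rfl⟩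
    have hij : i < j := hij
    have h1 := congrArg (fun v => s.repr v i) hxy
    have h2 := congrArg (fun v => s.repr v j) hxy
    simp [hij.ne, hij.ne'] at h1 h2
    exact ⟨h1, h2⟩
  · refine ⟨_, _, g, hpair fun x y hxy => ?_, hg g hgm, rfl⟩
    have hij : i < j := hij
    have hki : k ≠ i := hki
    have hkj : k ≠ j := hkj
    have h1 := congrArg (fun v => s.repr v i) hxy
    have h2 := congrArg (fun v => s.repr v k) hxy
    simp [hij.ne, hki, hkj, hki.symm] at h1 h2
    exact ⟨h1, h2⟩
  · refine ⟨_, _, g, hpair fun x y hxy => ?_, hg g hgm, rfl⟩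
    have hij : i < j := hij
    have hkl : k < l := hkl
    have hik : i < k := hik
    have hjk : j ≠ k := hjk
    have hil : i < l := hik.trans hkl
    have h1 := congrArg (fun v => s.repr v i) hxy
    have h2 := congrArg (fun v => s.repr v k) hxy
    simp [hij.ne', hkl.ne', hik.ne, hik.ne', hil.ne', hjk] at h1 h2
    exact ⟨h1, h2⟩

theorem finite_sumSet {V : Type*} [AddCommGroup V] {q : ℕ} (h : Fin q → V) :
    (sumSet h).Finite := by
  refine Set.Finite.union ((Set.finite_range h).subset ?_)
    ((Set.finite_range fun x : Fin q × Fin q => h x.1 + h x.2).subset ?_)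
  · rintro _ ⟨i, rfl⟩
    exact ⟨i, rfl⟩
  · rintro _ ⟨i, j, -, rfl⟩
    exact ⟨(i, j), rfl⟩

theorem finite_Gamma {ℓ m p q : ℕ} (hd : 2 * ℓ + m = d)
    (s : Module.Basis (Fin p) K (Sec K n ℓ)) (h : Module.Basis (Fin q) K (Sec K n m)) :
    (Gamma hd s h).Finite := by
  have hs : (Set.range s ∪ Set.range fun x : Fin p × Fin p => s x.1 + s x.2).Finite :=
    (Set.finite_range _).union (Set.finite_range _)
  refine (((hs.prod hs).prod (finite_sumSet h)).image fun x => Q hd x.1.1 x.1.2 x.2).subset ?_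
  rintro _ ((⟨i, j, -, g, hg, rfl⟩ | ⟨i, j, k, -, g, hg, rfl⟩) | ⟨i, j, k, l, -, g, hg, rfl⟩)
  · exact ⟨((s i, s j), g), ⟨⟨Or.inl ⟨i, rfl⟩, Or.inl ⟨j, rfl⟩⟩, hg⟩, rfl⟩
  · exact ⟨((s i + s j, s k), g), ⟨⟨Or.inr ⟨(i, j), rfl⟩, Or.inl ⟨k, rfl⟩⟩, hg⟩, rfl⟩
  · exact ⟨((s i + s j, s k + s l), g), ⟨⟨Or.inr ⟨(i, j), rfl⟩, Or.inr ⟨(k, l), rfl⟩⟩, hg⟩, rfl⟩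

end Ideal

/-! ### Rank three -/

section Rank

variable {K : Type*} [Field K] {n d : ℕ}

/-- If `l₀, l₁, l₂` are linearly independent linear forms then `l₀ l₂ - l₁²` has rank three. -/
theorem isQuadricOfRank_three {σ : Type*} [Fintype σ] (h2 : (2 : K) ≠ 0) (l : Fin 3 → σ → K)
    (hl : LinearIndependent K l) :
    IsQuadricOfRank ((∑ i, C (l 0 i) * X i) * (∑ i, C (l 2 i) * X i) -
      (∑ i, C (l 1 i) * X i) ^ 2 : MvPolynomial σ K) 3 := by
  classical
  -- The symmetric matrix of `y₀ y₂ - y₁²`; the required matrix is its pullback `Pᵀ N P` along the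
  -- rows `l`.
  let N : Matrix (Fin 3) (Fin 3) K := !![0, 0, 2⁻¹; 0, -1, 0; 2⁻¹, 0, 0]
  let P : Matrix (Fin 3) σ K := Matrix.of l
  have hN : N.transpose = N := by
    ext i j
    fin_cases i <;> fin_cases j <;> rfl
  have hNdet : IsUnit N.det := by
    rw [isUnit_iff_ne_zero, Matrix.det_fin_three]
    simp [N, h2]
  have hP : P.rank = 3 := by
    have : LinearIndependent K P.row := hl
    simpa using this.rank_matrix
  have hNP : (N * P).rank = 3 := by rw [Matrix.rank_mul_eq_right_of_isUnit_det _ _ hNdet, hP]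
  refine ⟨P.transpose * (N * P), ?_, ?_, ?_⟩
  · rw [Matrix.IsSymm, Matrix.transpose_mul, Matrix.transpose_mul, hN, Matrix.transpose_transpose,
      Matrix.mul_assoc]
  · have hinj : Function.Injective P.transpose.mulVecLin := by
      rw [← LinearMap.ker_eq_bot]
      rw [Matrix.ker_mulVecLin_eq_bot_iff]
      intro v hv
      rw [Matrix.mulVec_transpose] at hv
      have := Fintype.linearIndependent_iff.mp hl v (by
        ext i
        have := congrFun hv i
        simpa [Matrix.vecMul, dotProduct, P] using this)
      exact funext this
    rw [Matrix.rank, Matrix.mulVecLin_mul, LinearMap.range_comp,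
      LinearEquiv.finrank_eq (Submodule.equivMapOfInjective _ hinj _).symm, ← Matrix.rank, hNP]
  · have hM : ∀ i j, (P.transpose * (N * P)) i j =
        2⁻¹ * (l 0 i * l 2 j) + 2⁻¹ * (l 2 i * l 0 j) - l 1 i * l 1 j := by
      intro i j
      simp only [Matrix.mul_apply, Fin.sum_univ_three, Matrix.transpose_apply, P, Matrix.of_apply]
      simp [N]
      ring
    have h22 : (C 2⁻¹ : MvPolynomial σ K) * 2 = 1 := by
      rw [← C_1, ← inv_mul_cancel₀ h2, C_mul]
      rfl
    have hexp : ∀ u v : σ → K, (∑ i, C (u i) * X i) * (∑ i, C (v i) * X i) =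
        (∑ i, ∑ j, C (u i * v j) * X i * X j : MvPolynomial σ K) := by
      intro u v
      rw [Finset.sum_mul_sum]
      refine Finset.sum_congr rfl fun i _ => Finset.sum_congr rfl fun j _ => ?_
      rw [C_mul]
      ring
    have hM' : ∀ i j, (C ((P.transpose * (N * P)) i j) * X i * X j : MvPolynomial σ K) =
        C 2⁻¹ * (C (l 0 i * l 2 j) * X i * X j) + C 2⁻¹ * (C (l 2 i * l 0 j) * X i * X j) -
          C (l 1 i * l 1 j) * X i * X j := by
      intro i j
      simp only [hM, C_sub, C_add, C_mul]
      ring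
    simp only [hM', Finset.sum_sub_distrib, Finset.sum_add_distrib, ← Finset.mul_sum, ← hexp]
    linear_combination (-(∑ i, C (l 0 i) * X i) * (∑ i, C (l 2 i) * X i)) * h22

/-- Over an algebraically closed field a binary quadratic form with nonzero leading coefficient
splits into linear factors, and in a domain one factor would give a linear relation between `a` and
`b`. -/
theorem linearIndependent_sq_mul_sq [IsAlgClosed K] {A : Type*} [CommRing A] [IsDomain A]
    [Algebra K A] {a b : A} (hab : ∀ x y : K, x • a + y • b = 0 → x = 0 ∧ y = 0)
    (x y z : K) (h : x • (a * a) + y • (a * b) + z • (b * b) = 0) : x = 0 ∧ y = 0 ∧ z = 0 := by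
  by_cases hx : x = 0
  · subst hx
    have hb : b ≠ 0 := by
      rintro rfl
      exact one_ne_zero (hab 0 1 (by simp)).2
    have : b * (y • a + z • b) = 0 := by
      rw [← h]
      simp only [Algebra.smul_def, map_zero]
      ring
    exact ⟨rfl, hab y z ((mul_eq_zero.mp this).resolve_left hb)⟩
  · exfalso
    obtain ⟨r, hr⟩ : ∃ r : K, x * r ^ 2 + y * r + z = 0 := by
      have hdeg : (Polynomial.C x * Polynomial.X ^ 2 + Polynomial.C y * Polynomial.X +
          Polynomial.C z).degree = 2 := Polynomial.degree_quadratic hx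
      obtain ⟨r, hr⟩ := IsAlgClosed.exists_root _ (by rw [hdeg]; decide)
      exact ⟨r, by simpa using hr⟩
    have hr' := congrArg (algebraMap K A) hr
    simp only [map_add, map_mul, map_pow, map_zero] at hr'
    simp only [Algebra.smul_def] at h hab
    have hfac : ((algebraMap K A 1) * a + algebraMap K A (-r) * b) *
        (algebraMap K A x * a + algebraMap K A (y + x * r) * b) = 0 := by
      simp only [map_neg, map_add, map_mul, map_one]
      linear_combination h - b * b * hr'
    rcases mul_eq_zero.mp hfac with h1 | h1
    · exact one_ne_zero (hab _ _ h1).1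
    · exact hx (hab _ _ h1).1

/-- The three linear forms involved are the images under the injective `phi` of `s²g`, `stg`, `t²g`;
cancelling `g` reduces their independence to that of `s²`, `st`, `t²`. -/
theorem Q_isQuadricOfRank_three [IsAlgClosed K] (h2 : (2 : K) ≠ 0) {ℓ m : ℕ} (hd : 2 * ℓ + m = d)
    {s t : Sec K n ℓ} {g : Sec K n m} (hst : LinearIndependent K ![s, t]) (hg : g ≠ 0) :
    IsQuadricOfRank (Q hd s t g) 3 := by
  let l : Fin 3 → Idx n d → K := ![fun I => coeff I.1 (tripleProd hd s s g).1,
    fun I => coeff I.1 (tripleProd hd s t g).1, fun I => coeff I.1 (tripleProd hd t t g).1]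
  have hl : LinearIndependent K l := by
    rw [Fintype.linearIndependent_iff]
    intro c hc
    rw [Fin.sum_univ_three] at hc
    have h1 : phi n d (c 0 • tripleProd hd s s g + c 1 • tripleProd hd s t g +
        c 2 • tripleProd hd t t g) = phi n d 0 := by
      rw [map_zero, phi_apply]
      refine Finset.sum_eq_zero fun I _ => ?_
      have := congrFun hc I
      simp only [l, Pi.add_apply, Pi.smul_apply, Pi.zero_apply] at this
      simp only [Submodule.coe_add, Submodule.coe_smul, coeff_add, coeff_smul]
      erw [this]
      simp
    have h3 := congrArg Subtype.val (phi_injective h1)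
    simp only [tripleProd, Submodule.coe_add, Submodule.coe_smul, Submodule.coe_zero] at h3
    have h4 : (c 0 • (s.1 * s.1) + c 1 • (s.1 * t.1) + c 2 • (t.1 * t.1)) * g.1 = 0 := by
      rw [← h3]
      simp only [add_mul, smul_mul_assoc]
    have hg' : g.1 ≠ 0 := fun e => hg (Subtype.ext e)
    obtain ⟨e0, e1, e2⟩ := linearIndependent_sq_mul_sq (fun x y hxy =>
      LinearIndependent.pair_iff.mp hst x y (Subtype.ext (by simpa using hxy))) _ _ _
      ((mul_eq_zero.mp h4).resolve_right hg')
    intro i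
    fin_cases i
    exacts [e0, e1, e2]
  have := isQuadricOfRank_three h2 l hl
  simp only [Q, phi_apply]
  exact this

end Rank

/-! ### Polarization in characteristic three -/

section Polarization

variable {K V W R : Type*} [Field K] [AddCommGroup V] [Module K V] [AddCommGroup W] [Module K W]
  [CommRing R] [Algebra K R]

/-- The full polarization of `(s, t) ↦ Z s s g * Z t t g - Z s t g ^ 2` in characteristic three. -/
def symmForm (Z : V →ₗ[K] V →ₗ[K] W →ₗ[K] R) (g g' : W) (a b c e : V) : R :=
  Z a b g * Z c e g' + Z a c g * Z b e g' + Z a e g * Z b c g' + Z b c g * Z a e g' +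
    Z b e g * Z a c g' + Z c e g * Z a b g'

theorem forall_eq_zero_of_basis {ι M : Type*} [AddCommGroup M] [Module K M]
    (s : Module.Basis ι K M) {f : M → R} (hadd : ∀ x y, f (x + y) = f x + f y)
    (hsmul : ∀ (c : K) x, f (c • x) = c • f x) (h : ∀ i, f (s i) = 0) (x : M) : f x = 0 :=
  LinearMap.congr_fun (s.ext (f₁ := ({ toFun := f, map_add' := hadd, map_smul' := hsmul } : M →ₗ[K] R))
    (f₂ := 0) h) x

theorem symmForm_eq_zero_of_basis {ι : Type*} (s : Module.Basis ι K V)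
    {Z : V →ₗ[K] V →ₗ[K] W →ₗ[K] R} {g g' : W}
    (h : ∀ i j k l, symmForm Z g g' (s i) (s j) (s k) (s l) = 0) (a b c e : V) :
    symmForm Z g g' a b c e = 0 := by
  refine forall_eq_zero_of_basis s (f := fun x => symmForm Z g g' x b c e) ?_ ?_ (fun i => ?_) a
  · intro x y
    simp only [symmForm, map_add, LinearMap.add_apply]
    ring
  · intro x y
    simp only [symmForm, map_smul, LinearMap.smul_apply, Algebra.smul_def]
    ring
  refine forall_eq_zero_of_basis s (f := fun x => symmForm Z g g' (s i) x c e) ?_ ?_ (fun j => ?_) b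
  · intro x y
    simp only [symmForm, map_add, LinearMap.add_apply]
    ring
  · intro x y
    simp only [symmForm, map_smul, LinearMap.smul_apply, Algebra.smul_def]
    ring
  refine forall_eq_zero_of_basis s (f := fun x => symmForm Z g g' (s i) (s j) x e) ?_ ?_
    (fun k => ?_) c
  · intro x y
    simp only [symmForm, map_add, LinearMap.add_apply]
    ring
  · intro x y
    simp only [symmForm, map_smul, LinearMap.smul_apply, Algebra.smul_def]
    ring
  refine forall_eq_zero_of_basis s (f := fun x => symmForm Z g g' (s i) (s j) (s k) x) ?_ ?_
    (h i j k) e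
  · intro x y
    simp only [symmForm, map_add, LinearMap.add_apply]
    ring
  · intro x y
    simp only [symmForm, map_smul, LinearMap.smul_apply, Algebra.smul_def]
    ring

/-- For equal `g` the six-term form is twice the symmetric form `w` below, and each hypothesis is
the vanishing of some `w(x,x,y,y)`. Expanding `x = s_i + s_j`, then also `y = s_k + s_l`, yields `w`
on all index patterns; patterns with three equal indices vanish since `3 = 0`. -/
theorem symmForm_self_eq_zero {p : ℕ} (h3 : (3 : R) = 0) (s : Module.Basis (Fin p) K V)
    {Z : V →ₗ[K] V →ₗ[K] W →ₗ[K] R} (hZ : ∀ a b, Z a b = Z b a) {g : W}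
    (h1 : ∀ i j, i < j → Z (s i) (s i) g * Z (s j) (s j) g - Z (s i) (s j) g ^ 2 = 0)
    (h2 : ∀ i j k, i < j → k ≠ i → k ≠ j →
      Z (s i + s j) (s i + s j) g * Z (s k) (s k) g - Z (s i + s j) (s k) g ^ 2 = 0)
    (h4 : ∀ i j k l, i < j → k < l → i < k → j ≠ k → j ≠ l →
      Z (s i + s j) (s i + s j) g * Z (s k + s l) (s k + s l) g -
        Z (s i + s j) (s k + s l) g ^ 2 = 0) (a b c e : V) :
    symmForm Z g g a b c e = 0 := by
  refine symmForm_eq_zero_of_basis s (fun i j k l => ?_) a b c e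
  let w : Fin p → Fin p → Fin p → Fin p → R := fun i j k l =>
    Z (s i) (s j) g * Z (s k) (s l) g + Z (s i) (s k) g * Z (s j) (s l) g +
      Z (s i) (s l) g * Z (s j) (s k) g
  have comm : ∀ i j, Z (s i) (s j) g = Z (s j) (s i) g := fun i j => by rw [hZ]
  have w12 : ∀ i j k l, w i j k l = w j i k l := fun i j k l => by
    simp only [w, comm i j]; ring
  have w23 : ∀ i j k l, w i j k l = w i k j l := fun i j k l => by
    simp only [w, comm k j]; ring
  have w34 : ∀ i j k l, w i j k l = w i j l k := fun i j k l => by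
    simp only [w, comm k l]; ring
  have wiii : ∀ i k, w i i i k = 0 := fun i k => by
    simp only [w]
    linear_combination Z (s i) (s i) g * Z (s i) (s k) g * h3
  have wlt : ∀ i j, i < j → w i i j j = 0 := fun i j hij => by
    simp only [w]
    linear_combination h1 i j hij + Z (s i) (s j) g ^ 2 * h3
  have wiijj : ∀ i j, w i i j j = 0 := fun i j => by
    rcases lt_trichotomy i j with h | rfl | h
    · exact wlt i j h
    · exact wiii i i
    · rw [w23, w12, w34, w23, wlt j i h]
  have wlt2 : ∀ i j k, i < j → w i j k k = 0 := fun i j k hij => by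
    by_cases hki : k = i
    · simp only [hki, w, comm j i]
      linear_combination Z (s i) (s i) g * Z (s i) (s j) g * h3
    by_cases hkj : k = j
    · simp only [hkj, w]
      linear_combination Z (s i) (s j) g * Z (s j) (s j) g * h3
    have e := h2 i j k hij hki hkj
    have e1 := wiijj i k
    have e2 := wiijj j k
    simp only [w, map_add, LinearMap.add_apply, comm j i] at e e1 e2 ⊢
    linear_combination e1 + e2 - e + (Z (s i) (s j) g * Z (s k) (s k) g - Z (s i) (s k) g ^ 2 -
      Z (s j) (s k) g ^ 2) * h3
  have wijkk : ∀ i j k, w i j k k = 0 := fun i j k => by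
    rcases lt_trichotomy i j with h | rfl | h
    · exact wlt2 i j k h
    · exact wiijj i k
    · rw [w12, wlt2 j i k h]
  have wpair : ∀ i j k l, w i j k l = w k l i j := fun i j k l => by
    simp only [w, comm k i, comm l j, comm k j, comm l i]; ring
  have wsorted : ∀ i j k l, i < j → k < l → i < k → j ≠ k → j ≠ l → w i j k l = 0 := by
    intro i j k l hij hkl hik hjk hjl
    have e := h4 i j k l hij hkl hik hjk hjl
    have e1 := wiijj i k
    have e2 := wiijj i l
    have e3 := wiijj j k
    have e4 := wiijj j l
    have e5 := wijkk i j k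
    have e6 := wijkk i j l
    have e7 := (wpair i i k l).trans (wijkk k l i)
    have e8 := (wpair j j k l).trans (wijkk k l j)
    simp only [w, map_add, LinearMap.add_apply, comm j i, comm l k] at *
    -- In `w(x,x,y,y)` with `x = s_i + s_j`, `y = s_k + s_l` the term `w i j k l` has coefficient
    -- `4`. The multiple of `h3` accounts both for `4 = 1` and for `-1 = 2` in front of the square.
    linear_combination e - e1 - e2 - e3 - e4 - 2 * e5 - 2 * e6 - 2 * e7 - 2 * e8 +
      ((Z (s i) (s k) g + Z (s i) (s l) g + Z (s j) (s k) g + Z (s j) (s l) g) ^ 2 -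
      (Z (s i) (s j) g * Z (s k) (s l) g + Z (s i) (s k) g * Z (s j) (s l) g +
      Z (s i) (s l) g * Z (s j) (s k) g)) * h3
  have wlt4 : ∀ i j k l, i < j → k < l → i ≠ k → i ≠ l → j ≠ k → j ≠ l → w i j k l = 0 := by
    intro i j k l hij hkl hik hil hjk hjl
    rcases hik.lt_or_gt with h | h
    · exact wsorted i j k l hij hkl h hjk hjl
    · rw [wpair]
      exact wsorted k l i j hkl hij h hil.symm hjl.symm
  have wlt2' : ∀ i j k l, i < j → i ≠ k → i ≠ l → j ≠ k → j ≠ l → k ≠ l → w i j k l = 0 := by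
    intro i j k l hij hik hil hjk hjl hkl
    rcases hkl.lt_or_gt with h | h
    · exact wlt4 i j k l hij h hik hil hjk hjl
    · rw [w34]
      exact wlt4 i j l k hij h hil hik hjl hjk
  have main : w i j k l = 0 := by
    by_cases hkl : k = l
    · rw [hkl, wijkk]
    by_cases hij : i = j
    · rw [hij, wpair, wijkk]
    by_cases hik : i = k
    · rw [hik, w23, wpair, wijkk]
    by_cases hil : i = l
    · rw [hil, w34, w23, wpair, wijkk]
    by_cases hjk : j = k
    · rw [hjk, w12, w23, wpair, wijkk]
    by_cases hjl : j = l
    · rw [hjl, w12, w34, w23, wpair, wijkk]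
    rcases (Ne.lt_or_gt hij) with h | h
    · exact wlt2' i j k l h hik hil hjk hjl hkl
    · rw [w12]
      exact wlt2' j i k l h hjk hjl hik hil hkl
  have e : symmForm Z g g (s i) (s j) (s k) (s l) = 2 * w i j k l := by
    simp only [symmForm, w]; ring
  rw [e, main, mul_zero]

/-- Polarization in `g`: the values at `h i`, `h j` and `h i + h j` determine twice the mixed value,
and `2` is its own inverse. This is why `sumSet` contains the sums. -/
theorem symmForm_eq_zero {q : ℕ} (h : Module.Basis (Fin q) K W)
    {Z : V →ₗ[K] V →ₗ[K] W →ₗ[K] R}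
    (hself : ∀ g ∈ sumSet h, ∀ a b c e, symmForm Z g g a b c e = 0) (h3 : (3 : R) = 0)
    (g g' : W) (a b c e : V) : symmForm Z g g' a b c e = 0 := by
  have hlt : ∀ i j, i < j → symmForm Z (h i) (h j) a b c e = 0 := fun i j hij => by
    have e1 := hself _ (Or.inl ⟨i, rfl⟩) a b c e
    have e2 := hself _ (Or.inl ⟨j, rfl⟩) a b c e
    have e3 := hself _ (Or.inr ⟨i, j, hij, rfl⟩) a b c e
    simp only [symmForm, map_add] at e1 e2 e3 ⊢
    linear_combination 2 * e3 - 2 * e1 - 2 * e2 - (Z a b (h i) * Z c e (h j) + Z a c (h i) * Z b e (h j) + Z a e (h i) * Z b c (h j) +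
      Z b c (h i) * Z a e (h j) + Z b e (h i) * Z a c (h j) + Z c e (h i) * Z a b (h j)) * h3
  have hcomm : ∀ g g', symmForm Z g g' a b c e = symmForm Z g' g a b c e := fun g g' => by
    simp only [symmForm]; ring
  refine forall_eq_zero_of_basis h (f := fun x => symmForm Z x g' a b c e) ?_ ?_ (fun i => ?_) g
  · intro x y
    simp only [symmForm, map_add]
    ring
  · intro x y
    simp only [symmForm, map_smul, Algebra.smul_def]
    ring
  refine forall_eq_zero_of_basis h (f := fun x => symmForm Z (h i) x a b c e) ?_ ?_ (fun j => ?_) g'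
  · intro x y
    simp only [symmForm, map_add]
    ring
  · intro x y
    simp only [symmForm, map_smul, Algebra.smul_def]
    ring
  rcases lt_trichotomy i j with hij | rfl | hij
  · exact hlt i j hij
  · exact hself _ (Or.inl ⟨i, rfl⟩) a b c e
  · exact (hcomm _ _).trans (hlt j i hij)

end Polarization

/-! ### From Γ to the binomials -/

section Generation

variable {K : Type*} [Field K] {n d : ℕ}

theorem tripleProd_add_left {ℓ m : ℕ} (hd : 2 * ℓ + m = d) (s s' t : Sec K n ℓ) (h : Sec K n m) :
    tripleProd hd (s + s') t h = tripleProd hd s t h + tripleProd hd s' t h :=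
  Subtype.ext (by simp only [tripleProd, Submodule.coe_add]; ring)

theorem tripleProd_smul_left {ℓ m : ℕ} (hd : 2 * ℓ + m = d) (c : K) (s t : Sec K n ℓ)
    (h : Sec K n m) : tripleProd hd (c • s) t h = c • tripleProd hd s t h :=
  Subtype.ext (by simp only [tripleProd, Submodule.coe_smul, smul_mul_assoc])

theorem tripleProd_comm {ℓ m : ℕ} (hd : 2 * ℓ + m = d) (s t : Sec K n ℓ) (h : Sec K n m) :
    tripleProd hd s t h = tripleProd hd t s h :=
  Subtype.ext (by simp only [tripleProd, mul_comm s.1])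

theorem tripleProd_add_right {ℓ m : ℕ} (hd : 2 * ℓ + m = d) (s t : Sec K n ℓ) (h h' : Sec K n m) :
    tripleProd hd s t (h + h') = tripleProd hd s t h + tripleProd hd s t h' :=
  Subtype.ext (by simp only [tripleProd, Submodule.coe_add]; ring)

theorem tripleProd_smul_right {ℓ m : ℕ} (hd : 2 * ℓ + m = d) (c : K) (s t : Sec K n ℓ)
    (h : Sec K n m) : tripleProd hd s t (c • h) = c • tripleProd hd s t h :=
  Subtype.ext (by simp only [tripleProd, Submodule.coe_smul, mul_smul_comm])

/-- The product `(s, t, h) ↦ s ⊗ t ⊗ h` as a trilinear map, followed by a linear map `L`. -/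
def tripleMap {ℓ m : ℕ} (hd : 2 * ℓ + m = d) {R : Type*} [AddCommGroup R] [Module K R]
    (L : Sec K n d →ₗ[K] R) : Sec K n ℓ →ₗ[K] Sec K n ℓ →ₗ[K] Sec K n m →ₗ[K] R :=
  LinearMap.mk₂ K (fun s t =>
    { toFun := fun h => L (tripleProd hd s t h)
      map_add' := fun x y => by rw [tripleProd_add_right, map_add]
      map_smul' := fun c x => by rw [tripleProd_smul_right, map_smul, RingHom.id_apply] })
    (fun s s' t => LinearMap.ext fun h =>
      (congrArg L (tripleProd_add_left hd s s' t h)).trans (map_add L _ _))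
    (fun c s t => LinearMap.ext fun h =>
      (congrArg L (tripleProd_smul_left hd c s t h)).trans (map_smul L _ _))
    (fun s t t' => LinearMap.ext fun h =>
      (congrArg L (by rw [tripleProd_comm hd s, tripleProd_add_left, tripleProd_comm hd t,
        tripleProd_comm hd t'])).trans (map_add L (tripleProd hd s t h) (tripleProd hd s t' h)))
    (fun c s t => LinearMap.ext fun h =>
      (congrArg L (by rw [tripleProd_comm hd s, tripleProd_smul_left, tripleProd_comm hd t])).trans
        (map_smul L c (tripleProd hd s t h)))

/-- The trilinear map `(s, t, h) ↦ φ(s ⊗ t ⊗ h)`, with values modulo an ideal `J`. -/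
def tripleForm {ℓ m : ℕ} (hd : 2 * ℓ + m = d) (J : Ideal (MvPolynomial (Idx n d) K)) :
    Sec K n ℓ →ₗ[K] Sec K n ℓ →ₗ[K] Sec K n m →ₗ[K] (MvPolynomial (Idx n d) K ⧸ J) :=
  tripleMap hd ((Ideal.Quotient.mkₐ K J).toLinearMap ∘ₗ phi n d)

theorem tripleForm_apply {ℓ m : ℕ} (hd : 2 * ℓ + m = d) (J : Ideal (MvPolynomial (Idx n d) K))
    (s t : Sec K n ℓ) (h : Sec K n m) :
    tripleForm hd J s t h = Ideal.Quotient.mk J (phi n d (tripleProd hd s t h)) := rfl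

theorem mk_Q {ℓ m : ℕ} (hd : 2 * ℓ + m = d) (J : Ideal (MvPolynomial (Idx n d) K))
    (s t : Sec K n ℓ) (h : Sec K n m) :
    Ideal.Quotient.mk J (Q hd s t h) = tripleForm hd J s s h * tripleForm hd J t t h -
      tripleForm hd J s t h ^ 2 := by
  simp only [tripleForm_apply, Q, map_sub, map_mul, map_pow]

theorem tripleForm_comm {ℓ m : ℕ} (hd : 2 * ℓ + m = d) (J : Ideal (MvPolynomial (Idx n d) K))
    (s t : Sec K n ℓ) : tripleForm hd J s t = tripleForm hd J t s := by
  refine LinearMap.ext fun h => ?_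
  rw [tripleForm_apply, tripleForm_apply, tripleProd_comm]

theorem three_eq_zero_quotient [CharP K 3] (J : Ideal (MvPolynomial (Idx n d) K)) :
    (3 : MvPolynomial (Idx n d) K ⧸ J) = 0 := by
  have h : (3 : K) = 0 := by exact_mod_cast CharP.cast_eq_zero K 3
  have := congrArg (algebraMap K (MvPolynomial (Idx n d) K ⧸ J)) h
  rwa [map_ofNat, map_zero] at this

theorem symmForm_tripleForm_span_Gamma [CharP K 3] {ℓ m p q : ℕ} (hd : 2 * ℓ + m = d)
    (s : Module.Basis (Fin p) K (Sec K n ℓ)) (h : Module.Basis (Fin q) K (Sec K n m))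
    (g g' : Sec K n m) (a b c e : Sec K n ℓ) :
    symmForm (tripleForm hd (Ideal.span (Gamma hd s h))) g g' a b c e = 0 := by
  have hQ : ∀ {a b g}, Q hd a b g ∈ Gamma hd s h →
      tripleForm hd (Ideal.span (Gamma hd s h)) a a g *
        tripleForm hd (Ideal.span (Gamma hd s h)) b b g -
          tripleForm hd (Ideal.span (Gamma hd s h)) a b g ^ 2 = 0 := fun hmem => by
    rw [← mk_Q]
    exact Ideal.Quotient.eq_zero_iff_mem.mpr (Ideal.subset_span hmem)
  refine symmForm_eq_zero h (fun g hg a b c e => ?_) (three_eq_zero_quotient _) g g' a b c e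
  refine symmForm_self_eq_zero (three_eq_zero_quotient _) s (tripleForm_comm hd _) ?_ ?_ ?_ a b c e
  · exact fun i j hij => hQ (Or.inl (Or.inl ⟨i, j, hij, g, hg, rfl⟩))
  · exact fun i j k hij hki hkj => hQ (Or.inl (Or.inr ⟨i, j, k, ⟨hij, hki, hkj⟩, g, hg, rfl⟩))
  · exact fun i j k l hij hkl hik hjk hjl =>
      hQ (Or.inr ⟨i, j, k, l, ⟨hij, hkl, hik, hjk, hjl⟩, g, hg, rfl⟩)

theorem sum_toFinsupp {ι : Type*} [Fintype ι] [DecidableEq ι] (A : Multiset ι) :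
    ∑ i, A.toFinsupp i = A.card := by
  rw [← A.toFinsupp_sum_eq, Finsupp.sum_fintype _ _ (by simp)]
  rfl

/-- The function `f` on `A(n,d)`, read as a function of multisets of size `d`. -/
def onMultiset {R : Type*} [Zero R] (f : Idx n d → R) (A : Multiset (Fin (n + 1))) : R :=
  if h : A.card = d then f ⟨A.toFinsupp, (sum_toFinsupp A).trans h⟩ else 0

theorem onMultiset_toMultiset {R : Type*} [Zero R] (f : Idx n d → R) (A : Idx n d) :
    onMultiset f A.1.toMultiset = f A := by
  have h : A.1.toMultiset.card = d := by
    rw [← sum_toFinsupp, Finsupp.toMultiset_toFinsupp, A.2]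
  rw [onMultiset, dif_pos h]
  congr 1
  exact Subtype.ext (Finsupp.toMultiset_toFinsupp _)

/-- This turns `symmForm` at coordinates and monomials into `sixTerm`: multiplying monomials is
adding multisets. -/
theorem tripleForm_X_X_monomial {m : ℕ} (hd : 2 * 1 + m = d)
    (J : Ideal (MvPolynomial (Idx n d) K)) (a b : Fin (n + 1)) (S : Multiset (Fin (n + 1)))
    (hS : monomial S.toFinsupp 1 ∈ Sec K n m) (hS' : S.card = m) :
    tripleForm hd J ⟨X a, isHomogeneous_X K a⟩ ⟨X b, isHomogeneous_X K b⟩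
      ⟨monomial S.toFinsupp 1, hS⟩ =
      onMultiset (fun A => Ideal.Quotient.mk J (X A)) (a ::ₘ b ::ₘ S) := by
  have hcard : (a ::ₘ b ::ₘ S).card = d := by simp; omega
  have e : (X a * X b * monomial S.toFinsupp 1 : MvPolynomial (Fin (n + 1)) K) =
      monomial (a ::ₘ b ::ₘ S).toFinsupp 1 := by
    rw [X, X, monomial_mul, monomial_mul, one_mul, one_mul]
    congr 1
    rw [← Multiset.singleton_add, ← Multiset.singleton_add b, Multiset.toFinsupp_add,
      Multiset.toFinsupp_add, Multiset.toFinsupp_singleton, Multiset.toFinsupp_singleton, add_assoc]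
  have hm : monomial (a ::ₘ b ::ₘ S).toFinsupp 1 ∈ Sec K n d := by
    rw [← e]
    exact (tripleProd hd ⟨X a, isHomogeneous_X K a⟩ ⟨X b, isHomogeneous_X K b⟩ ⟨_, hS⟩).2
  have e' : tripleProd hd ⟨X a, isHomogeneous_X K a⟩ ⟨X b, isHomogeneous_X K b⟩
      ⟨monomial S.toFinsupp 1, hS⟩ = ⟨monomial (a ::ₘ b ::ₘ S).toFinsupp 1, hm⟩ := Subtype.ext e
  rw [onMultiset, dif_pos hcard, tripleForm_apply, e',
    phi_monomial ⟨(a ::ₘ b ::ₘ S).toFinsupp, (sum_toFinsupp _).trans hcard⟩ hm]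

/-- In characteristic three and for `d ≥ 3`, the quadrics in `Γ(𝒪(1), 𝒪(d-2))` span all the
binomials `z_A z_B - z_A' z_B'` with `A + B = A' + B'`. -/
theorem mk_X_mul_mk_X_eq [CharP K 3] {m p q : ℕ} (hd : 2 * 1 + m = d) (hd3 : 3 ≤ d)
    (s : Module.Basis (Fin p) K (Sec K n 1)) (h : Module.Basis (Fin q) K (Sec K n m))
    (A B A' B' : Idx n d) (hAB : A.1 + B.1 = A'.1 + B'.1) :
    Ideal.Quotient.mk (Ideal.span (Gamma hd s h)) (X A) *
        Ideal.Quotient.mk (Ideal.span (Gamma hd s h)) (X B) =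
      Ideal.Quotient.mk (Ideal.span (Gamma hd s h)) (X A') *
        Ideal.Quotient.mk (Ideal.span (Gamma hd s h)) (X B') := by
  set J := Ideal.span (Gamma hd s h) with hJ
  let f : Idx n d → MvPolynomial (Idx n d) K ⧸ J := fun A => Ideal.Quotient.mk J (X A)
  have hcard : ∀ A : Idx n d, A.1.toMultiset.card = d := fun A => by
    rw [← sum_toFinsupp, Finsupp.toMultiset_toFinsupp, A.2]
  have := eq_of_add_eq_add (F := fun A B => onMultiset f A * onMultiset f B)
    (three_eq_zero_quotient J) (fun A B => mul_comm _ _) ?_ hd3 (hcard A) (hcard B) (hcard A')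
    (B' := B'.1.toMultiset)
    (by rw [← Finsupp.toMultiset_add, ← Finsupp.toMultiset_add, hAB])
  · simpa only [onMultiset_toMultiset] using this
  · intro S S' a b c e hS hS'
    have hmem : ∀ S : Multiset (Fin (n + 1)), S.card + 2 = d →
        (monomial S.toFinsupp 1 : MvPolynomial (Fin (n + 1)) K) ∈ Sec K n m := fun S hS => by
      refine isHomogeneous_monomial _ ?_
      rw [Finsupp.degree_eq_sum, sum_toFinsupp]
      omega
    have key := symmForm_tripleForm_span_Gamma hd s h ⟨_, hmem S hS⟩ ⟨_, hmem S' hS'⟩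
      ⟨X a, isHomogeneous_X K a⟩ ⟨X b, isHomogeneous_X K b⟩ ⟨X c, isHomogeneous_X K c⟩
      ⟨X e, isHomogeneous_X K e⟩
    have h1 : S.card = m := by omega
    have h2 : S'.card = m := by omega
    simpa only [symmForm, tripleForm_X_X_monomial, h1, h2, sixTerm] using key

end Generation

end Veronese

end

theorem theorem3p2 {K : Type*} [Field K] [IsAlgClosed K] [CharP K 3] (n d : ℕ) (hn : 1 ≤ n)
    (hd : 3 ≤ d) {p q : ℕ} (s : Module.Basis (Fin p) K (Veronese.Sec K n 1))
    (h : Module.Basis (Fin q) K (Veronese.Sec K n (d - 2))) :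
    (Veronese.Gamma (show 2 * 1 + (d - 2) = d by omega) s h).Finite ∧
    (∀ F ∈ Veronese.Gamma (show 2 * 1 + (d - 2) = d by omega) s h,
      Veronese.IsQuadricOfRank F 3) ∧
    Ideal.span (Veronese.Gamma (show 2 * 1 + (d - 2) = d by omega) s h) =
      Veronese.homogeneousIdeal (Veronese.veroneseVariety K n d) := by
  have hdd : 2 * 1 + (d - 2) = d := by omega
  refine ⟨Veronese.finite_Gamma _ s h, fun F hF => ?_, le_antisymm ?_ ?_⟩
  · have h2 : (2 : K) ≠ 0 := by
      intro h2
      have h3 : (3 : K) = 0 := by exact_mod_cast CharP.cast_eq_zero K 3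
      exact one_ne_zero (by linear_combination h3 - h2 : (1 : K) = 0)
    obtain ⟨a, b, g, hab, hg, rfl⟩ := Veronese.exists_eq_Q_of_mem_Gamma hF
    exact Veronese.Q_isQuadricOfRank_three h2 _ hab hg
  · rw [Ideal.span_le]
    intro F hF
    obtain ⟨a, b, g, -, -, rfl⟩ := Veronese.exists_eq_Q_of_mem_Gamma hF
    exact Veronese.Q_mem_homogeneousIdeal _ a b g
  · have := IsAlgClosed.instInfinite (K := K)
    exact Veronese.homogeneousIdeal_le_ker_pullback.trans
      (Veronese.ker_pullback_le (by omega) _ (Veronese.mk_X_mul_mk_X_eq hdd hd s h))
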